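/- Consider $n$ players with finite action sets, where player $i$ submits a program. Program $p_i$ takes as input the other players' programs $p_{-i}$, a shared sequence $(r_m)_{m\ge 0}\in[0,1]^{\infty}$ and a private sequence $(x_m)_{m\ge 0}\in[0,1]^{\infty}$, and outputs an action of player $i$. Programs run on a random-access machine with real registers (for the random numbers and their comparison with thresholds), and every executed instruction, loop test or call costs one step, so that comparing $r_t$ with a threshold takes constant time. A program may simulate: $\mathrm{apply}^*(p_j,(p_{-j},(r_m)_{m\ge s},(x_m)))$ runs $p_j$ on these inputs and returns its output if this run does not itself access the private sequence (accesses made inside further $\mathrm{apply}^*$ calls do not count), and returns the special symbol $R_j$ otherwise; the steps of the simulated run count towards the runtime. With memoization, the results of all completed $\mathrm{apply}^*$ calls are stored during a run, and a repeated $\mathrm{apply}^*$ call with the same program and the same input sequences is answered from the store in one step. A policy $\pi_i$ for player $i$ is given by code without $\mathrm{apply}^*$ calls that, on every history $\mathbf a^{1:t}$ ($t\ge 0$; each entry $a_j^{t'}$ is an action of player $j$ or the symbol $R_j$) and all values of $r_0,x_0\in[0,1]$ (the only random numbers it may read), halts and outputs an action of player $i$. For $\epsilon\in\mathbb R$, the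 correlated $\epsilon$Grounded$\pi_i$Bot is the program $p_i$ that on input $(p_{-i},(r_m),(x_m))$ computes $T=\min\{t : r_t<\epsilon\}$ by testing $t=0,1,2,\dots$ in turn; then, for $t=1,\dots,T$ and $j=1,\dots,n$, computes $a_j^t=\mathrm{apply}^*(p_j,(p_{-j},(r_m)_{m\ge T+1-t},(x_m)_{m\ge 0}))$; and finally runs $\pi_i$ on $\mathbf a^{1:T}$, $r_0$, $x_0$ and returns its output. The expected runtime of $p_i$ against $p_{-i}$ is the expected number of steps of $p_i$ on this input (infinite on inputs on which it does not halt) when $(r_m)$ and $(x_m)$ are independent sequences of i.i.d. $U[0,1]$ variables. Suppose that $p_i$ is a correlated $\epsilon_i$Grounded$\pi_i$Bot for $i=1,\dots,n$. (1) If $\epsilon_i<1/2$ for at least two indices $i$, then, without memoization, every $p_i$ with $\epsilon_i<1$ has infinite expected runtime against $p_{-i}$. (2) With memoization, if $\epsilon_i>0$ for all $i$ and the policies run in polynomial time, i.e. there is a polynomial $Q$ such that every $\pi_i$ takes at most $Q(t)$ steps on every history of length $t$ (for all $r_0,x_0$), then the expected runtime of every $p_i$ against $p_{-i}$ is finite and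 polynomial in $1/\min_j\epsilon_j$: it is at most $P(1/\min_j\epsilon_j)$ for a polynomial $P$ that depends only on $n$ and $Q$. -/

import Mathlib

open MeasureTheory
open scoped ENNReal

namespace ProgramGame

/-!  ## The machine: a random-access machine with real registers

Programs are structured programs for a random-access machine with natural-number memory
(indirectly addressed), real registers (used for the random numbers and comparisons of random numbers
with thresholds), a list of the answers received from simulations, and a unit cost for every
executed instruction.
-/

/-- Elementary instructions.  Natural-number memory cells are addressed by natural numbers; `d` is
always the destination.  The `real` registers are separate. -/
inductive Instr
  /-- `mem d := k` -/
  | const (d k : ℕ)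
  /-- `mem d := mem d + 1` -/
  | inc (d : ℕ)
  /-- `mem d := mem d - 1` (truncated) -/
  | dec (d : ℕ)
  /-- `mem d := mem a + mem b` -/
  | add (d a b : ℕ)
  /-- `mem d := mem a - mem b` (truncated) -/
  | sub (d a b : ℕ)
  /-- `mem d := mem (mem a)` -/
  | load (d a : ℕ)
  /-- `mem (mem d) := mem a` -/
  | store (d a : ℕ)
  /-- `mem d :=` number of simulation answers received so far -/
  | len (d : ℕ)
  /-- `mem d :=` code of the simulation answer number `mem a` (`0` is the screening symbol,
  `v + 1` is the action `v`) -/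
  | ans (d a : ℕ)
  /-- `real d := r_m`, the shared random sequence, direct addressing -/
  | readR (d m : ℕ)
  /-- `real d := r_{mem a}`, the shared random sequence, indirect addressing -/
  | readRAt (d a : ℕ)
  /-- `real d := x_m`, the private random sequence, direct addressing -/
  | readX (d m : ℕ)
  /-- `real d := x_{mem a}`, the private random sequence, indirect addressing -/
  | readXAt (d a : ℕ)
  /-- `real d := c` -/
  | rconst (d : ℕ) (c : ℝ)
  /-- `real d := mem a` -/
  | rofNat (d a : ℕ)
  /-- `real d := real a + real b` -/
  | radd (d a b : ℕ)
  /-- `real d := real a - real b` -/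
  | rsub (d a b : ℕ)
  /-- `real d := real a * real b` -/
  | rmul (d a b : ℕ)
  /-- `real d := real a / real b` -/
  | rdiv (d a b : ℕ)
  /-- `mem d := 1` if `real a ≤ real b`, and `mem d := 0` otherwise -/
  | rle (d a b : ℕ)

/-- Programs of an `n`-player correlated program game.  `call j a` executes
`apply*(p_j, (p_{-j}, (r_m)_{m ≥ mem a}, (x_m)))` and appends the answer to the list of answers. -/
inductive Code (n : ℕ)
  | instr (c : Instr)
  | seq (c₁ c₂ : Code n)
  /-- repeat `c` as long as `mem a ≠ 0` -/
  | loop (a : ℕ) (c : Code n)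
  | call (j : Fin n) (a : ℕ)

/-- The local state of a running program. `accessed` records whether the program itself (not a program
that it simulates) has accessed the private random sequence.  In `answers`, `none` is the screening
symbol `R_j` and `some v` is the action `v`. -/
structure State where
  mem : ℕ → ℕ
  real : ℕ → ℝ
  answers : List (Option ℕ)
  accessed : Bool

/-- The state in which all registers are zero, with a given list of answers. -/
def State.init (h : List (Option ℕ)) : State := ⟨fun _ => 0, fun _ => 0, h, false⟩

/-- The action that a halted program outputs. -/
def State.output (σ : State) : ℕ := σ.mem 0

/-- What an `apply*` call returns when the called program has halted in state `σ`: the screening symbol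
if it accessed the private random sequence, its output otherwise. -/
def State.screenedOutput (σ : State) : Option ℕ := if σ.accessed then none else some σ.output

/-- Write to memory. -/
def State.setMem (σ : State) (d v : ℕ) : State := { σ with mem := Function.update σ.mem d v }

/-- Write to a real register. -/
noncomputable def State.setReal (σ : State) (d : ℕ) (v : ℝ) : State :=
  { σ with real := Function.update σ.real d v }

/-- Append an answer. -/
def State.push (σ : State) (v : Option ℕ) : State := { σ with answers := σ.answers ++ [v] }

/-- The effect of an instruction in a program whose input sequences are `(r_m)_{m ≥ s}` and `(x_m)`. -/
noncomputable def Instr.exec (r x : ℕ → unitInterval) (s : ℕ) (σ : State) : Instr → State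
  | const d k => σ.setMem d k
  | inc d => σ.setMem d (σ.mem d + 1)
  | dec d => σ.setMem d (σ.mem d - 1)
  | add d a b => σ.setMem d (σ.mem a + σ.mem b)
  | sub d a b => σ.setMem d (σ.mem a - σ.mem b)
  | load d a => σ.setMem d (σ.mem (σ.mem a))
  | store d a => σ.setMem (σ.mem d) (σ.mem a)
  | len d => σ.setMem d σ.answers.length
  | ans d a => σ.setMem d (match σ.answers[σ.mem a]? with
      | some (some v) => v + 1
      | _ => 0)
  | readR d m => σ.setReal d (r (s + m))
  | readRAt d a => σ.setReal d (r (s + σ.mem a))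
  | readX d m => { σ.setReal d (x m) with accessed := true }
  | readXAt d a => { σ.setReal d (x (σ.mem a)) with accessed := true }
  | rconst d c => σ.setReal d c
  | rofNat d a => σ.setReal d (σ.mem a)
  | radd d a b => σ.setReal d (σ.real a + σ.real b)
  | rsub d a b => σ.setReal d (σ.real a - σ.real b)
  | rmul d a b => σ.setReal d (σ.real a * σ.real b)
  | rdiv d a b => σ.setReal d (σ.real a / σ.real b)
  | rle d a b => σ.setMem d (open Classical in if σ.real a ≤ σ.real b then 1 else 0)

/-- The memo table: the stored results of completed calls `apply*(p_j, (p_{-j}, (r_m)_{m ≥ s}, (x_m)))`,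
indexed by `(j, s)`. -/
abbrev Table (n : ℕ) := Fin n × ℕ → Option (Option ℕ)

/-- `Exec p memo r x s c σ M σ' M' k`: in the program profile `p`, with or without memoization, the code
`c`, run with input sequences `(r_m)_{m ≥ s}` and `(x_m)` from state `σ` and memo table `M`, halts in
state `σ'` with memo table `M'` after `k` steps.  Every elementary instruction, every loop test and
every call takes one step; the steps of a called program are added, unless the call is answered from
the memo table. -/
inductive Exec {n : ℕ} (p : Fin n → Code n) (memo : Bool) (r x : ℕ → unitInterval) :
    ℕ → Code n → State → Table n → State → Table n → ℕ → Prop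
  | instr (s : ℕ) (c : Instr) (σ : State) (M : Table n) :
      Exec p memo r x s (.instr c) σ M (c.exec r x s σ) M 1
  | seq {s : ℕ} {c₁ c₂ : Code n} {σ₀ σ₁ σ₂ : State} {M₀ M₁ M₂ : Table n} {k₁ k₂ : ℕ} :
      Exec p memo r x s c₁ σ₀ M₀ σ₁ M₁ k₁ → Exec p memo r x s c₂ σ₁ M₁ σ₂ M₂ k₂ →
      Exec p memo r x s (.seq c₁ c₂) σ₀ M₀ σ₂ M₂ (k₁ + k₂)
  | loopDone {s a : ℕ} {c : Code n} {σ : State} {M : Table n} : σ.mem a = 0 →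
      Exec p memo r x s (.loop a c) σ M σ M 1
  | loopStep {s a : ℕ} {c : Code n} {σ₀ σ₁ σ₂ : State} {M₀ M₁ M₂ : Table n} {k₁ k₂ : ℕ} :
      σ₀.mem a ≠ 0 →
      Exec p memo r x s c σ₀ M₀ σ₁ M₁ k₁ → Exec p memo r x s (.loop a c) σ₁ M₁ σ₂ M₂ k₂ →
      Exec p memo r x s (.loop a c) σ₀ M₀ σ₂ M₂ (1 + k₁ + k₂)
  | callRun {s a : ℕ} {j : Fin n} {σ σ' : State} {M M' : Table n} {k : ℕ} :
      memo = false ∨ M (j, s + σ.mem a) = none →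
      Exec p memo r x (s + σ.mem a) (p j) (State.init []) M σ' M' k →
      Exec p memo r x s (.call j a) σ M (σ.push σ'.screenedOutput)
        (if memo then Function.update M' (j, s + σ.mem a) (some σ'.screenedOutput) else M') (1 + k)
  | callHit {s a : ℕ} {j : Fin n} {σ : State} {M : Table n} {v : Option ℕ} :
      memo = true → M (j, s + σ.mem a) = some v →
      Exec p memo r x s (.call j a) σ M (σ.push v) M 1

/-- The machine is deterministic; in particular the number of steps of a halting run is unique. -/
theorem Exec.det {n : ℕ} {p : Fin n → Code n} {memo : Bool} {r x : ℕ → unitInterval} {s : ℕ} {c : Code n}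
    {σ σ₁ σ₂ : State} {M M₁ M₂ : Table n} {k₁ k₂ : ℕ}
    (h₁ : Exec p memo r x s c σ M σ₁ M₁ k₁) (h₂ : Exec p memo r x s c σ M σ₂ M₂ k₂) :
    σ₁ = σ₂ ∧ M₁ = M₂ ∧ k₁ = k₂ := by
  induction h₁ generalizing σ₂ M₂ k₂ with
  | instr => cases h₂; exact ⟨rfl, rfl, rfl⟩
  | seq _ _ ih₁ ih₂ =>
    cases h₂ with
    | seq a b =>
      obtain ⟨rfl, rfl, rfl⟩ := ih₁ a
      obtain ⟨rfl, rfl, rfl⟩ := ih₂ b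
      exact ⟨rfl, rfl, rfl⟩
  | loopDone h =>
    cases h₂ with
    | loopDone => exact ⟨rfl, rfl, rfl⟩
    | loopStep h' => exact absurd h h'
  | loopStep h _ _ ih₁ ih₂ =>
    cases h₂ with
    | loopDone h' => exact absurd h' h
    | loopStep _ a b =>
      obtain ⟨rfl, rfl, rfl⟩ := ih₁ a
      obtain ⟨rfl, rfl, rfl⟩ := ih₂ b
      exact ⟨rfl, rfl, rfl⟩
  | callRun h _ ih =>
    cases h₂ with
    | callRun _ b =>
      obtain ⟨rfl, rfl, rfl⟩ := ih b
      exact ⟨rfl, rfl, rfl⟩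
    | callHit h' h'' => simp_all
  | callHit h h' =>
    cases h₂ with
    | callRun h'' => simp_all
    | callHit h'' h''' => simp_all

/-- The number of steps that the code `c`, started in the state `State.init h` with an empty memo table
and with input sequences `(r_m)` and `(x_m)`, takes to halt; `⊤` if it does not halt. -/
noncomputable def runtime {n : ℕ} (p : Fin n → Code n) (memo : Bool) (r x : ℕ → unitInterval) (c : Code n)
    (h : List (Option ℕ)) : ℕ∞ :=
  sInf {T : ℕ∞ | ∃ (σ : State) (M : Table n) (k : ℕ),
    Exec p memo r x 0 c (State.init h) (fun _ => none) σ M k ∧ T = k}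

/-- The expected number of steps of program `p i` against `p_{-i}`, where the shared sequence and the
private sequence are independent i.i.d. `U[0,1]` sequences. -/
noncomputable def expectedRuntime {n : ℕ} (p : Fin n → Code n) (memo : Bool) (i : Fin n) : ℝ≥0∞ :=
  ∫⁻ ω : (ℕ → unitInterval) × (ℕ → unitInterval), (runtime p memo ω.1 ω.2 (p i) [] : ℝ≥0∞)
    ∂((Measure.infinitePi fun _ : ℕ => (volume : Measure unitInterval)).prod
      (Measure.infinitePi fun _ : ℕ => (volume : Measure unitInterval)))

/-! ## Policies -/

/-- Instructions of a policy: the only random numbers that it may read are `r_0` and `x_0`. -/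
def Instr.IsLocal : Instr → Prop
  | readR _ m => m = 0
  | readX _ m => m = 0
  | readRAt _ _ => False
  | readXAt _ _ => False
  | _ => True

/-- Code of a policy: makes no calls and reads no random numbers except `r_0` and `x_0`. -/
def Code.IsLocal {n : ℕ} : Code n → Prop
  | instr c => c.IsLocal
  | seq c₁ c₂ => c₁.IsLocal ∧ c₂.IsLocal
  | loop _ c => c.IsLocal
  | call _ _ => False

/-- `h` lists, time step by time step and within a time step player by player, the entries of a screened
history of length `t`, where player `j` has the actions `0, …, K j - 1`. -/
def IsHistory {n : ℕ} (K : Fin n → ℕ) (t : ℕ) (h : List (Option ℕ)) : Prop :=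
  h.length = t * n ∧
    ∀ τ < t, ∀ j : Fin n, ∀ v : ℕ, h[τ * n + j]? = some (some v) → v < K j

/-- A profile of programs for code that makes no calls. -/
def noPrograms (n : ℕ) : Fin n → Code n := fun _ => .instr (.const 0 0)

/-- The code `π` computes a policy for player `i`: on every screened history and all values of `r_0` and
`x_0`, it halts and outputs an action of player `i`. -/
structure IsPolicy {n : ℕ} (K : Fin n → ℕ) (i : Fin n) (π : Code n) : Prop where
  isLocal : π.IsLocal
  halts : ∀ (t : ℕ) (h : List (Option ℕ)), IsHistory K t h → ∀ r x : ℕ → unitInterval,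
    ∃ (σ : State) (M : Table n) (k : ℕ),
      Exec (noPrograms n) false r x 0 π (State.init h) (fun _ => none) σ M k ∧ σ.output < K i

/-- On screened histories of length `t`, the policy `π` runs for at most `Q(t)` steps. -/
def RunsInTime {n : ℕ} (K : Fin n → ℕ) (π : Code n) (Q : Polynomial ℕ) : Prop :=
  ∀ (t : ℕ) (h : List (Option ℕ)), IsHistory K t h → ∀ r x : ℕ → unitInterval,
    runtime (noPrograms n) false r x π h ≤ (Q.eval t : ℕ)

/-! ## The bots -/

/-- `for j = 1 to n: a_j ← apply*(p_j, (p_{-j}, (r_m)_{m ≥ mem 0}, (x_m)))`, then `c`. -/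
def callAll (n : ℕ) (c : Code n) : Code n :=
  (List.finRange n).foldr (fun j c' => .seq (.call j 0) c') c

/-- `mem 1 := 1` if `ε ≤ r_{mem 0}`, and `mem 1 := 0` otherwise, where `real 0 = ε`. -/
def testR (n : ℕ) : Code n := .seq (.instr (.readRAt 1 0)) (.instr (.rle 1 0 1))

/-- `mem 0 ← T = min {t : r_t < ε}` -/
noncomputable def findT (n : ℕ) (ε : ℝ) : Code n :=
  .seq (.instr (.rconst 0 ε)) <|
  .seq (testR n) <|
  .loop 1 (.seq (.instr (.inc 0)) (testR n))

/-- `for t = 1 to T: for j = 1 to n: a_j^t ← apply*(p_j, (p_{-j}, (r_m)_{m ≥ T+1-t}, (x_m)))`,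
where `mem 0` holds `T` initially and `T+1-t` in round `t`. -/
def simulate (n : ℕ) : Code n := .loop 0 (callAll n (.instr (.dec 0)))

/-- The correlated `ε`Grounded`π`Bot.  It finds `T`, makes its simulations, and runs the policy `π` on the
history of the answers, after setting the real registers that it has used back to zero (the memory is
already zero at that point). -/
noncomputable def groundedBot {n : ℕ} (ε : ℝ) (π : Code n) : Code n :=
  .seq (findT n ε) <|
  .seq (simulate n) <|
  .seq (.instr (.rconst 0 0)) <|
  .seq (.instr (.rconst 1 0)) π

end ProgramGame

namespace ProgramGame

variable {n : ℕ}

/-! Without memoization, fix a player `j` with threshold `ε < 1/2` and count only the simulations of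
`p j` by itself. A run at shift `s` with `r_s ≥ ε` simulates `p j` at the shifts `s+1, …, s+T`. The
simulations at `s+2, …, s+T` are those that a run at `s+1` makes, so the count satisfies `C(s) = 1 +
2 C(s+1)`, and `C(s) = 0` if `r_s < ε`. Cut off at depth `d` (`selfCalls`), its expectation obeys
`e_{d+1} = q (1 + 2 e_d) ≥ 1/2 + e_d` with `q = P(r_0 ≥ ε) ≥ 1/2`, hence `e_d ≥ d/2`. Any bot `i`
with `ε i < 1` simulates `p j` at shift `1` whenever `r_0 ≥ ε i`. This event has positive
probability and is independent of the sequence from shift `1` on, so the expected runtime exceeds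
every bound (`Exec.selfCalls_lt`, `le_lintegral_selfCalls`).

With memoization, let `N` be the first index with `r_N < ε₀`, where `ε₀` is at most every threshold.
No run at a shift up to `N` makes a call beyond `N`, so at most `n (N+1)` pairs of player and shift
are ever simulated, each only once. Charging the own steps of each run to its table entry bounds the
runtime by a polynomial in `N` (`haltsWithin_groundedBot`, `runtime_groundedBot_le`). As `N` is
geometric, its moments are polynomial in `1/ε₀` (`lintegral_hitBound`). -/

/-- Code that makes no calls and reads only `r_0` and `x_0` runs in the same way in every program profile,
with or without memoization. -/
theorem Exec.transport_of_isLocal {p q : Fin n → Code n} {memo memo' : Bool}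
    {r x r' x' : ℕ → unitInterval} {s s' : ℕ} {c : Code n} {σ σ' : State} {M M' : Table n} {k : ℕ}
    (hr : r' (s' + 0) = r (s + 0)) (hx : x' 0 = x 0)
    (h : Exec p memo r x s c σ M σ' M' k) (hc : c.IsLocal) (N : Table n) :
    Exec q memo' r' x' s' c σ N σ' N k := by
  induction h with
  | instr s c σ M =>
    have : c.exec r x s σ = c.exec r' x' s' σ := by
      cases c <;> simp_all [Code.IsLocal, Instr.IsLocal, Instr.exec]
    rw [this]
    exact .instr _ _ _ _
  | seq _ _ ih₁ ih₂ => exact .seq (ih₁ hr hc.1) (ih₂ hr hc.2)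
  | loopDone h => exact .loopDone h
  | loopStep h _ _ ih₁ ih₂ => exact .loopStep h (ih₁ hr hc) (ih₂ hr hc)
  | callRun _ _ _ => exact hc.elim
  | callHit _ _ => exact hc.elim

/-! ### Register states of a bot and its search for `T` -/

/-- Appending several answers. -/
def State.pushAll (σ : State) (vs : List (Option ℕ)) : State := { σ with answers := σ.answers ++ vs }

/-- The states that a grounded bot reaches before it runs its policy. -/
noncomputable def botState (t b : ℕ) (ε ρ : ℝ) (h : List (Option ℕ)) : State where
  mem m := if m = 0 then t else if m = 1 then b else 0
  real m := if m = 0 then ε else if m = 1 then ρ else 0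
  answers := h
  accessed := false

/-- Once the bot has cleared its registers, the policy starts in exactly the state that `IsPolicy`
and `RunsInTime` speak of. -/
theorem botState_zero (h : List (Option ℕ)) : botState 0 0 0 0 h = State.init h := by
  simp [botState, State.init]

/-- The result of the comparison `ε ≤ u`, as a number. -/
noncomputable def leBit (ε u : ℝ) : ℕ := open Classical in if ε ≤ u then 1 else 0

theorem setMem_zero_botState (t t' b : ℕ) (ε ρ : ℝ) (h : List (Option ℕ)) :
    (botState t b ε ρ h).setMem 0 t' = botState t' b ε ρ h := by
  simp only [State.setMem, botState, State.mk.injEq, and_true]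
  funext m
  by_cases hm : m = 0 <;> simp [hm]

theorem setMem_one_botState (t b b' : ℕ) (ε ρ : ℝ) (h : List (Option ℕ)) :
    (botState t b ε ρ h).setMem 1 b' = botState t b' ε ρ h := by
  simp only [State.setMem, botState, State.mk.injEq, and_true]
  funext m
  by_cases hm : m = 1 <;> simp [hm]

theorem setReal_zero_botState (t b : ℕ) (ε ε' ρ : ℝ) (h : List (Option ℕ)) :
    (botState t b ε ρ h).setReal 0 ε' = botState t b ε' ρ h := by
  simp only [State.setReal, botState, State.mk.injEq, and_true, true_and]
  funext m
  by_cases hm : m = 0 <;> simp [hm]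

theorem setReal_one_botState (t b : ℕ) (ε ρ ρ' : ℝ) (h : List (Option ℕ)) :
    (botState t b ε ρ h).setReal 1 ρ' = botState t b ε ρ' h := by
  simp only [State.setReal, botState, State.mk.injEq, and_true, true_and]
  funext m
  by_cases hm : m = 1 <;> simp [hm]

/-- `T` is the least `t` with `r_t < ε`, for the shared sequence `(r_m)_{m ≥ s}`. -/
def IsFirstBelow (r : ℕ → unitInterval) (s : ℕ) (ε : ℝ) (T : ℕ) : Prop :=
  (∀ m < T, ε ≤ r (s + m)) ∧ (r (s + T) : ℝ) < ε

theorem exists_isFirstBelow {r : ℕ → unitInterval} {s t : ℕ} {ε : ℝ} (h : (r (s + t) : ℝ) < ε) :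
    ∃ T ≤ t, IsFirstBelow r s ε T := by
  classical
  have hex : ∃ t, (r (s + t) : ℝ) < ε := ⟨t, h⟩
  exact ⟨Nat.find hex, Nat.find_min' hex h, fun m hm => not_lt.1 (Nat.find_min hex hm),
    Nat.find_spec hex⟩

variable {p : Fin n → Code n} {memo : Bool} {r x : ℕ → unitInterval}

theorem exec_testR (s t b : ℕ) (ε ρ : ℝ) (h : List (Option ℕ)) (M : Table n) :
    Exec p memo r x s (testR n) (botState t b ε ρ h) M
      (botState t (leBit ε (r (s + t))) ε (r (s + t)) h) M 2 := by
  have h₁ := Exec.instr (p := p) (memo := memo) (r := r) (x := x) s (.readRAt 1 0)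
    (botState t b ε ρ h) M
  have h₂ := Exec.instr (p := p) (memo := memo) (r := r) (x := x) s (.rle 1 0 1)
    (botState t b ε (r (s + t)) h) M
  rw [Instr.exec, setReal_one_botState] at h₁
  rw [Instr.exec, setMem_one_botState] at h₂
  exact .seq h₁ h₂

theorem exec_findT_body (s t b : ℕ) (ε ρ : ℝ) (h : List (Option ℕ)) (M : Table n) :
    Exec p memo r x s (.seq (.instr (.inc 0)) (testR n)) (botState t b ε ρ h) M
      (botState (t + 1) (leBit ε (r (s + (t + 1)))) ε (r (s + (t + 1))) h) M 3 := by
  have h₁ := Exec.instr (p := p) (memo := memo) (r := r) (x := x) s (.inc 0) (botState t b ε ρ h) M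
  rw [Instr.exec, setMem_zero_botState] at h₁
  exact .seq h₁ (exec_testR s (t + 1) b ε ρ h M)

/-- An iteration costs four steps, one for the loop test and three for the body; the failing test at
the end accounts for the `+ 1`. -/
theorem exec_findT_loop {s T : ℕ} {ε : ℝ} (hT : IsFirstBelow r s ε T) (h : List (Option ℕ))
    (M : Table n) (d t : ℕ) (hd : t + d = T) :
    Exec p memo r x s (.loop 1 (.seq (.instr (.inc 0)) (testR n)))
      (botState t (leBit ε (r (s + t))) ε (r (s + t)) h) M
      (botState T 0 ε (r (s + T)) h) M (4 * d + 1) := by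
  induction d generalizing t with
  | zero =>
    obtain rfl : t = T := by omega
    have hb : leBit ε (r (s + t)) = 0 := by simp [leBit, hT.2]
    rw [hb]
    exact .loopDone (by simp [botState])
  | succ d ih =>
    have hb : leBit ε (r (s + t)) = 1 := by simp [leBit, hT.1 t (by omega)]
    have := Exec.loopStep (a := 1) (by simp [botState, hb])
      (exec_findT_body (p := p) (memo := memo) (x := x) s t (leBit ε (r (s + t))) ε (r (s + t)) h M)
      (ih (t + 1) (by omega))
    convert this using 1
    ring

theorem exec_findT {s T : ℕ} {ε : ℝ} (hT : IsFirstBelow r s ε T) (M : Table n) :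
    Exec p memo r x s (findT n ε) (State.init []) M
      (botState T 0 ε (r (s + T)) []) M (4 * T + 4) := by
  have h₁ := Exec.instr (p := p) (memo := memo) (r := r) (x := x) s (.rconst 0 ε)
    (botState 0 0 0 0 []) M
  rw [Instr.exec, setReal_zero_botState, botState_zero] at h₁
  have := h₁.seq ((exec_testR s 0 0 ε 0 [] M).seq
    (exec_findT_loop (p := p) (memo := memo) (x := x) hT [] M T 0 (by simp)))
  rw [show 4 * T + 4 = 1 + (2 + (4 * T + 1)) by ring]
  exact this

/-- For the lower bound, the existence of `T` has to be extracted from halting: while the entries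
stay at least `ε` the loop bit stays `1`, and the remaining loop is a strictly shorter run. -/
theorem exists_lt_of_exec_findT_loop {s t k : ℕ} {ε : ℝ} {h : List (Option ℕ)} {M M' : Table n}
    {σ : State}
    (hk : Exec p memo r x s (.loop 1 (.seq (.instr (.inc 0)) (testR n)))
      (botState t (leBit ε (r (s + t))) ε (r (s + t)) h) M σ M' k) :
    ∃ T, (r (s + T) : ℝ) < ε := by
  induction k using Nat.strong_induction_on generalizing t M with
  | _ k ih =>
    by_cases hlt : (r (s + t) : ℝ) < ε
    · exact ⟨t, hlt⟩
    · cases hk with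
      | loopDone h0 => simp [botState, leBit, not_lt.1 hlt] at h0
      | loopStep _ hb hl =>
        obtain ⟨rfl, rfl, rfl⟩ := hb.det (exec_findT_body s t _ ε _ h M)
        exact ih _ (by omega) hl

/-- If the search for `T` halts, then `T` exists and the search has found it. -/
theorem Exec.findT_inv {s k : ℕ} {ε : ℝ} {M M' : Table n} {σ : State}
    (hk : Exec p memo r x s (findT n ε) (State.init []) M σ M' k) :
    ∃ T, IsFirstBelow r s ε T ∧ σ = botState T 0 ε (r (s + T)) [] := by
  have hlt : ∃ T, (r (s + T) : ℝ) < ε := by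
    cases hk with
    | seq h₁ h₂ =>
      cases h₂ with
      | seq h₂ h₃ =>
        cases h₁
        rw [← botState_zero, Instr.exec, setReal_zero_botState] at h₂
        obtain ⟨rfl, rfl, rfl⟩ := h₂.det (exec_testR s 0 0 ε 0 [] M)
        exact exists_lt_of_exec_findT_loop h₃
  obtain ⟨t, ht⟩ := hlt
  obtain ⟨T, -, hT⟩ := exists_isFirstBelow ht
  exact ⟨T, hT, (hk.det (exec_findT hT M)).1⟩

/-! ## Without memoization -/

/-- A lower bound for the steps of all calls of the program `p a` is a lower bound for the steps of a list
of calls that contains one of `p a`. -/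
theorem Exec.foldr_call_inv {s a K : ℕ} {j : Fin n} {L : ℕ → ℕ}
    (hL : ∀ s' M σ' M' k, k < K →
      Exec p false r x s' (p j) (State.init []) M σ' M' k → L s' ≤ k)
    (l : List (Fin n)) (c : Code n) {σ σ' : State} {M M' : Table n} {k : ℕ} (hkK : k ≤ K)
    (hk : Exec p false r x s (l.foldr (fun j c' => .seq (.call j a) c') c) σ M σ' M' k) :
    ∃ vs M₁ k₁, Exec p false r x s c (σ.pushAll vs) M₁ σ' M' k₁ ∧ k₁ ≤ k ∧
      (j ∈ l → L (s + σ.mem a) + k₁ ≤ k) := by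
  induction l generalizing σ M k with
  | nil => exact ⟨[], M, k, by simpa [State.pushAll] using hk, le_rfl, by simp⟩
  | cons i l ih =>
    cases hk with
    | @seq _ _ _ _ _ _ _ _ _ k₁ k₂ h₁ h₂ =>
      cases h₁ with
      | callHit h => simp at h
      | @callRun _ _ _ _ σ₁ _ M₁ k₁ _ h₁ =>
        obtain ⟨vs, M₂, k₃, h₃, hle, hmem⟩ := ih (by omega) h₂
        refine ⟨σ₁.screenedOutput :: vs, M₂, k₃, ?_, by omega, fun hj => ?_⟩
        · simpa [State.pushAll, State.push] using h₃
        · rcases List.mem_cons.1 hj with rfl | hj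
          · have := hL _ _ _ _ _ (by omega) h₁
            omega
          · have := hmem hj
            simp only [State.push] at this
            omega

/-- The bound `L` is required only for runs shorter than `K`, so that it can serve as the hypothesis
of a strong induction on the number of steps. Rounds run from the largest shift down, so the first
round contributes the last summand. -/
theorem Exec.simulate_inv {s K : ℕ} {j : Fin n} {L : ℕ → ℕ}
    (hL : ∀ s' M σ' M' k, k < K →
      Exec p false r x s' (p j) (State.init []) M σ' M' k → L s' ≤ k)
    (t : ℕ) {σ σ' : State} {M M' : Table n} {k : ℕ} (hkK : k ≤ K) (ht : σ.mem 0 = t)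
    (hk : Exec p false r x s (simulate n) σ M σ' M' k) :
    ∑ m ∈ Finset.range t, L (s + (m + 1)) < k := by
  induction t generalizing σ M k with
  | zero => cases hk <;> simp
  | succ t ih =>
    cases hk with
    | loopDone h => omega
    | loopStep _ h₁ h₂ =>
      obtain ⟨vs, M₁, k₃, h₃, -, hle⟩ := h₁.foldr_call_inv hL _ _ (by omega)
      replace hle := hle (List.mem_finRange j)
      cases h₃
      have := ih (by omega) (by simp [Instr.exec, State.setMem, State.pushAll, ht]) h₂
      rw [Finset.sum_range_succ]
      rw [ht] at hle
      omega

/-- A halting grounded bot takes more steps than the simulations of player `j` in it. -/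
theorem Exec.groundedBot_inv {s K : ℕ} {j : Fin n} {L : ℕ → ℕ} {ε : ℝ} {π : Code n}
    (hL : ∀ s' M σ' M' k, k < K →
      Exec p false r x s' (p j) (State.init []) M σ' M' k → L s' ≤ k)
    {σ' : State} {M M' : Table n} {k : ℕ} (hkK : k ≤ K)
    (hk : Exec p false r x s (groundedBot ε π) (State.init []) M σ' M' k) :
    ∃ T, IsFirstBelow r s ε T ∧ ∑ m ∈ Finset.range T, L (s + (m + 1)) < k := by
  cases hk with
  | seq h₁ h₂ =>
    cases h₂ with
    | seq h₂ h₃ =>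
      obtain ⟨T, hT, rfl⟩ := h₁.findT_inv
      have := h₂.simulate_inv hL T (by omega) (by simp [botState])
      exact ⟨T, hT, by omega⟩

end ProgramGame

/-! ### Doubling of the number of self-simulations -/

namespace ProgramGame

variable {n : ℕ} {p : Fin n → Code n} {memo : Bool} {r x : ℕ → unitInterval}

/-- Up to depth `d`, the number of simulations of the same program that a bot with threshold `ε` starts,
directly or indirectly. -/
noncomputable def selfCalls (ε : ℝ) : ℕ → ℕ → (ℕ → unitInterval) → ℕ
  | 0, _, _ => 0
  | d + 1, s, r => open Classical in if ε ≤ r s then 1 + 2 * selfCalls ε d (s + 1) r else 0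

theorem selfCalls_le_succ (ε : ℝ) (d s : ℕ) (r : ℕ → unitInterval) :
    selfCalls ε d s r ≤ selfCalls ε (d + 1) s r := by
  induction d generalizing s with
  | zero => simp [selfCalls]
  | succ d ih =>
    rw [selfCalls, selfCalls]
    have := ih (s + 1)
    split_ifs <;> omega

theorem selfCalls_shift (ε : ℝ) (d s : ℕ) (r : ℕ → unitInterval) :
    selfCalls ε d (s + 1) r = selfCalls ε d s (fun m => r (m + 1)) := by
  induction d generalizing s with
  | zero => rfl
  | succ d ih => simp only [selfCalls, ih]

/-- In the sum, the term `m = 0` is one simulation together with the count at `s + 1`, and the other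
terms dominate the count at `s + 1` once more, by induction on `T`. This is the recursion `1 + 2
C(s+1)`, up to the loss of one level of depth. -/
theorem selfCalls_le_sum {ε : ℝ} {T : ℕ} (d : ℕ) {s : ℕ} (hT : IsFirstBelow r s ε T) :
    selfCalls ε d s r ≤ ∑ m ∈ Finset.range T, (1 + selfCalls ε d (s + (m + 1)) r) := by
  induction T generalizing s with
  | zero =>
    cases d with
    | zero => simp [selfCalls]
    | succ d => simpa [selfCalls] using hT.2
  | succ T ih =>
    have hT' : IsFirstBelow r (s + 1) ε T :=
      ⟨fun m hm => by rw [add_assoc, add_comm 1]; exact hT.1 (m + 1) (by omega),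
        by rw [add_assoc, add_comm 1]; exact hT.2⟩
    have h := ih hT'
    -- Unfolding the left side lowers the depth by one while the terms of the sum keep depth `d`;
    -- monotonicity in the depth closes the gap.
    have hs := selfCalls_le_succ ε (d - 1) (s + 1) r
    rw [Finset.sum_range_succ']
    simp only [Nat.add_assoc, Nat.add_comm 1] at h ⊢
    cases d with
    | zero => simp [selfCalls]
    | succ d =>
      rw [selfCalls]
      simp only [Nat.add_sub_cancel] at hs
      split_ifs <;> simp only [Nat.zero_add] at * <;> omega

/-- Simulated runs are strictly shorter than the run that contains them, so strong induction on the
step count applies even though the shifts that occur are not bounded in advance. -/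
theorem Exec.selfCalls_lt {ε : ℝ} {π : Code n} {j : Fin n} (hj : p j = groundedBot ε π) (d : ℕ)
    {s k : ℕ} {σ : State} {M M' : Table n}
    (hk : Exec p false r x s (p j) (State.init []) M σ M' k) : 1 + selfCalls ε d s r ≤ k := by
  induction k using Nat.strong_induction_on generalizing s σ M M' with
  | _ k ih =>
    rw [hj] at hk
    obtain ⟨T, hT, hlt⟩ := hk.groundedBot_inv (j := j) (L := fun s => 1 + selfCalls ε d s r)
      (fun s' M σ' M' k hk h => ih k hk h) le_rfl
    have := selfCalls_le_sum d hT
    omega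

theorem selfCalls_le_runtime {ε ε' : ℝ} {π π' : Code n} {i j : Fin n} (hi : p i = groundedBot ε π)
    (hj : p j = groundedBot ε' π') (d : ℕ) (h0 : ε ≤ r 0) :
    (selfCalls ε' d 1 r : ℕ∞) ≤ runtime p false r x (p i) [] := by
  refine le_sInf ?_
  rintro _ ⟨σ, M, k, hk, rfl⟩
  rw [hi] at hk
  obtain ⟨T, hT, hlt⟩ := hk.groundedBot_inv (j := j) (L := fun s => 1 + selfCalls ε' d s r)
    (fun s' M σ' M' k _ h => h.selfCalls_lt hj d) le_rfl
  cases T with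
  | zero => exact absurd hT.2 (by simpa using h0)
  | succ T =>
    -- Only the term `m = 0`, the simulation at shift `1`, is kept.
    rw [Finset.sum_range_succ'] at hlt
    norm_cast
    simp only [Nat.zero_add] at hlt
    omega

/-! ### The law of the shared sequence -/

/-- The law of a sequence of independent uniformly distributed random variables. -/
noncomputable abbrev uniformSeq : Measure (ℕ → unitInterval) :=
  Measure.infinitePi fun _ : ℕ => (volume : Measure unitInterval)

/-- Prepending an entry to a sequence. -/
def seqCons (z : unitInterval × (ℕ → unitInterval)) : ℕ → unitInterval
  | 0 => z.1
  | m + 1 => z.2 m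

theorem measurable_seqCons : Measurable seqCons := by
  refine measurable_pi_lambda _ fun m => ?_
  cases m with
  | zero => exact measurable_fst
  | succ m => exact (measurable_pi_apply m).comp measurable_snd

theorem map_seqCons :
    ((volume : Measure unitInterval).prod uniformSeq).map seqCons = uniformSeq := by
  refine Measure.eq_infinitePi _ fun s t ht => ?_
  classical
  rw [Measure.map_apply measurable_seqCons (.pi s.countable_toSet fun i _ => ht i)]
  -- A box over `s` splits into a condition on the prepended entry, present only if `0 ∈ s`, and a
  -- box over the shifted indices.
  let u : Finset ℕ := s.preimage (· + 1) (add_left_injective 1).injOn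
  have hpre : seqCons ⁻¹' (Set.pi s t) =
      (if 0 ∈ s then t 0 else Set.univ) ×ˢ Set.pi u (fun m => t (m + 1)) := by
    ext ⟨a, b⟩
    simp only [Set.mem_preimage, Set.mem_pi, Set.mem_prod, SetLike.mem_coe]
    constructor
    · intro h
      refine ⟨?_, fun m hm => h (m + 1) (by simpa [u] using hm)⟩
      split_ifs with h0
      · exact h 0 h0
      · trivial
    · rintro ⟨h0, h⟩ m hm
      cases m with
      | zero =>
        rw [if_pos hm] at h0
        exact h0
      | succ m => exact h m (by simpa [u] using hm)
  rw [hpre, Measure.prod_prod, Measure.infinitePi_pi _ fun i _ => ht (i + 1)]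
  have hs : s.erase 0 = u.image (· + 1) := by
    ext m
    cases m <;> simp [u]
  have hprod : ∏ i ∈ s.erase 0, (volume : Measure unitInterval) (t i) =
      ∏ i ∈ u, (volume : Measure unitInterval) (t (i + 1)) := by
    rw [hs, Finset.prod_image fun a _ b _ h => by simpa using h]
  rw [← hprod]
  split_ifs with h0
  · exact Finset.mul_prod_erase s (fun i => volume (t i)) h0
  · rw [measure_univ, one_mul, Finset.erase_eq_of_notMem h0]

/-- The first entry is independent of the shifted sequence, and the shifted sequence has the same
law. -/
theorem lintegral_uniformSeq_indicator {A : Set unitInterval} (hA : MeasurableSet A)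
    {f : (ℕ → unitInterval) → ℝ≥0∞} (hf : Measurable f) :
    ∫⁻ r, {r | r 0 ∈ A}.indicator (fun r => f fun m => r (m + 1)) r ∂uniformSeq =
      volume A * ∫⁻ r, f r ∂uniformSeq := by
  have hm : Measurable ({r : ℕ → unitInterval | r 0 ∈ A}.indicator
      (fun r => f fun m => r (m + 1))) :=
    (hf.comp (by fun_prop)).indicator (measurable_pi_apply 0 hA)
  rw [← map_seqCons, lintegral_map hm measurable_seqCons, map_seqCons,
    ← lintegral_indicator_one hA, ← lintegral_prod_mul (by fun_prop) hf.aemeasurable]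
  refine lintegral_congr fun z => ?_
  by_cases hz : z.1 ∈ A <;> simp [Set.indicator, seqCons, hz]

theorem measurable_selfCalls (ε : ℝ) (d s : ℕ) : Measurable (selfCalls ε d s) := by
  classical
  induction d generalizing s with
  | zero => exact measurable_const
  | succ d ih =>
    have : selfCalls ε (d + 1) s =
        fun r => if ε ≤ r s then 1 + 2 * selfCalls ε d (s + 1) r else 0 := by
      funext r
      simp [selfCalls]
    rw [this]
    refine Measurable.ite (measurableSet_le measurable_const (by fun_prop)) ?_ measurable_const
    exact (measurable_from_nat (f := fun k => 1 + 2 * k)).comp (ih (s + 1))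

theorem measurableSet_le_coe (ε : ℝ) : MeasurableSet {u : unitInterval | ε ≤ u} :=
  measurableSet_le measurable_const measurable_subtype_coe

theorem volume_le_coe {ε : ℝ} (h₀ : 0 ≤ ε) (h₁ : ε ≤ 1) :
    volume {u : unitInterval | ε ≤ u} = ENNReal.ofReal (1 - ε) :=
  unitInterval.volume_Ici ⟨ε, h₀, h₁⟩

theorem volume_le_coe_anti {ε ε' : ℝ} (h : ε ≤ ε') :
    volume {u : unitInterval | ε' ≤ u} ≤ volume {u : unitInterval | ε ≤ u} :=
  measure_mono fun _ hu => h.trans hu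

theorem le_lintegral_selfCalls {ε : ℝ} (hε : ε < 1 / 2) (d : ℕ) :
    (d : ℝ≥0∞) / 2 ≤ ∫⁻ r, (selfCalls ε d 0 r : ℝ≥0∞) ∂uniformSeq := by
  have hq : 2⁻¹ ≤ volume {u : unitInterval | ε ≤ u} := by
    refine le_trans ?_ (volume_le_coe_anti hε.le)
    rw [volume_le_coe (by norm_num) (by norm_num)]
    rw [show (1 : ℝ) - 1 / 2 = 2⁻¹ by norm_num, ENNReal.ofReal_inv_of_pos (by norm_num)]
    simp
  induction d with
  | zero => simp
  | succ d ih =>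
    have hG : Measurable fun r => (selfCalls ε d 0 r : ℝ≥0∞) :=
      (measurable_from_nat (f := fun k : ℕ => (k : ℝ≥0∞))).comp (measurable_selfCalls ε d 0)
    have hrec : ∀ r, (selfCalls ε (d + 1) 0 r : ℝ≥0∞) =
        {r : ℕ → unitInterval | r 0 ∈ {u : unitInterval | ε ≤ u}}.indicator
          (fun r => (fun r => 1 + 2 * (selfCalls ε d 0 r : ℝ≥0∞)) fun m => r (m + 1)) r := by
      intro r
      rw [selfCalls, selfCalls_shift]
      by_cases h : ε ≤ r 0 <;> simp [Set.indicator, h]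
    rw [lintegral_congr hrec, lintegral_uniformSeq_indicator 
      (f := fun r => 1 + 2 * (selfCalls ε d 0 r : ℝ≥0∞)) (measurableSet_le_coe ε) (by fun_prop),
      lintegral_add_left measurable_const, lintegral_const_mul _ hG, lintegral_one, measure_univ]
    calc ((d + 1 : ℕ) : ℝ≥0∞) / 2 = 2⁻¹ * (1 + 2 * (d / 2)) := by
          rw [ENNReal.mul_div_cancel (by simp) (by simp), ENNReal.div_eq_inv_mul]
          push_cast
          rw [add_comm]
      _ ≤ _ := by gcongr

/-- Without memoization, the expected runtime of a bot with threshold below `1` is infinite as soon as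
some bot has a threshold below `1 / 2`. -/
theorem expectedRuntime_eq_top {ε : Fin n → ℝ} {π : Fin n → Code n} {i j : Fin n}
    (hj : ε j < 1 / 2) (hi : ε i < 1) :
    expectedRuntime (fun j => groundedBot (ε j) (π j)) false i = ⊤ := by
  set A : Set unitInterval := {u | ε i ≤ u}
  have hA : volume A ≠ 0 := by
    -- The threshold may be negative; raising it to `max (ε i) 0` shrinks the set and brings it into
    -- the range of `volume_le_coe`.
    refine (lt_of_lt_of_le ?_ (volume_le_coe_anti (le_max_left (ε i) 0))).ne'
    rw [volume_le_coe (le_max_right _ _) (by simp [hi.le])]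
    simpa using hi
  have hbound : ∀ d : ℕ, volume A * ((d : ℝ≥0∞) / 2) ≤
      expectedRuntime (fun j => groundedBot (ε j) (π j)) false i := by
    intro d
    have hG : Measurable fun r => (selfCalls (ε j) d 0 r : ℝ≥0∞) :=
      (measurable_from_nat (f := fun k : ℕ => (k : ℝ≥0∞))).comp (measurable_selfCalls _ d 0)
    have hm : Measurable ({r : ℕ → unitInterval | r 0 ∈ A}.indicator
        (fun r => (selfCalls (ε j) d 0 fun m => r (m + 1) : ℝ≥0∞))) :=
      (hG.comp (by fun_prop)).indicator (measurable_pi_apply 0 (measurableSet_le_coe _))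
    calc volume A * ((d : ℝ≥0∞) / 2)
        ≤ volume A * ∫⁻ r, (selfCalls (ε j) d 0 r : ℝ≥0∞) ∂uniformSeq := by
          gcongr
          exact le_lintegral_selfCalls hj d
      _ = ∫⁻ r, {r : ℕ → unitInterval | r 0 ∈ A}.indicator
            (fun r => (selfCalls (ε j) d 0 fun m => r (m + 1) : ℝ≥0∞)) r ∂uniformSeq :=
          (lintegral_uniformSeq_indicator (measurableSet_le_coe _) hG).symm
      _ = ∫⁻ ω, {r : ℕ → unitInterval | r 0 ∈ A}.indicator
            (fun r => (selfCalls (ε j) d 0 fun m => r (m + 1) : ℝ≥0∞)) ω.1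
            ∂(uniformSeq.prod uniformSeq) :=
          (measurePreserving_fst.lintegral_comp hm).symm
      _ ≤ _ := by
          refine lintegral_mono fun ω => ?_
          by_cases h : ω.1 0 ∈ A
          · have := selfCalls_le_runtime (p := fun j => groundedBot (ε j) (π j)) (r := ω.1)
              (x := ω.2) (i := i) (j := j) rfl rfl d h
            rw [selfCalls_shift] at this
            simpa [Set.indicator, h] using ENat.toENNReal_mono this
          · simp [Set.indicator, h]
  by_contra hne
  obtain ⟨d, hd⟩ := ENNReal.exists_nat_mul_gt (a := volume A / 2) (by simp [hA]) hne
  refine (hbound d).not_gt (hd.trans_le (le_of_eq ?_))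
  simp only [div_eq_mul_inv]
  ring

end ProgramGame

namespace ProgramGame

variable {n : ℕ} {p : Fin n → Code n} {r x : ℕ → unitInterval}

/-! ## With memoization -/

/-- An answer to a simulation of a player with the actions `0, …, k - 1`. -/
def IsAnswer (k : ℕ) (v : Option ℕ) : Prop := ∀ w, v = some w → w < k

/-- All stored results are answers. -/
def Table.Valid (K : Fin n → ℕ) (M : Table n) : Prop := ∀ j s v, M (j, s) = some v → IsAnswer (K j) v

/-- The number of stored results at shifts up to `N`. -/
def Table.size (N : ℕ) (M : Table n) : ℕ :=
  ((Finset.univ ×ˢ Finset.range (N + 1)).filter fun e => (M e).isSome).card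

theorem Table.size_le (N : ℕ) (M : Table n) : M.size N ≤ n * (N + 1) :=
  (Finset.card_filter_le _ _).trans (by simp)

theorem Table.size_empty (N : ℕ) : Table.size N (fun _ => none : Table n) = 0 := by
  simp [Table.size]

theorem Table.size_update {N s : ℕ} {j : Fin n} {M : Table n} (hs : s ≤ N) (hM : M (j, s) = none)
    (v : Option ℕ) : Table.size N (Function.update M (j, s) (some v)) = M.size N + 1 := by
  classical
  rw [Table.size, Table.size, ← Finset.card_insert_of_notMem (a := (j, s)) (by simp [hM])]
  congr 1
  ext e
  by_cases he : e = (j, s)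
  · subst he
    simp
    omega
  · simp [he]

/-- The tables `M` and `M'` agree at all shifts up to `s`. -/
def Table.AgreeUpTo (s : ℕ) (M M' : Table n) : Prop := ∀ j, ∀ s' ≤ s, M' (j, s') = M (j, s')

theorem Table.AgreeUpTo.refl (s : ℕ) (M : Table n) : AgreeUpTo s M M := fun _ _ _ => rfl

theorem Table.AgreeUpTo.trans {s : ℕ} {M₁ M₂ M₃ : Table n} (h₁ : AgreeUpTo s M₁ M₂)
    (h₂ : AgreeUpTo s M₂ M₃) : AgreeUpTo s M₁ M₃ :=
  fun j s' h => (h₂ j s' h).trans (h₁ j s' h)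

/-- Started with any valid table, `p j` with the shared sequence `(r_m)_{m ≥ s}` halts with an action of
player `j`, leaves the table valid and unchanged up to the shift `s`, and takes at most `B` steps for
itself and for each result that it adds to the table. -/
def HaltsWithin (p : Fin n → Code n) (r x : ℕ → unitInterval) (K : Fin n → ℕ) (N B s : ℕ) (j : Fin n) :
    Prop :=
  ∀ M : Table n, M.Valid K → ∃ σ M' k, Exec p true r x s (p j) (State.init []) M σ M' k ∧
    σ.output < K j ∧ M'.Valid K ∧ Table.AgreeUpTo s M M' ∧ k + B * M.size N ≤ B + B * M'.size N

/-- The caller pays one step. If the call is not answered from the table, the allowance `B` for the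
called run itself is paid by the entry that the call adds. -/
theorem HaltsWithin.exec_call {K : Fin n → ℕ} {N B s a : ℕ} {j : Fin n} {σ : State}
    (h : HaltsWithin p r x K N B (s + σ.mem a) j) (h0 : σ.mem a ≠ 0) (hN : s + σ.mem a ≤ N)
    {M : Table n} (hM : M.Valid K) :
    ∃ v M' k, Exec p true r x s (.call j a) σ M (σ.push v) M' k ∧ IsAnswer (K j) v ∧ M'.Valid K ∧
      Table.AgreeUpTo s M M' ∧ k + B * M.size N ≤ 1 + B * M'.size N := by
  cases hv : M (j, s + σ.mem a) with
  | some v => exact ⟨v, M, 1, .callHit rfl hv, hM _ _ _ hv, hM, .refl _ _, le_rfl⟩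
  | none =>
    obtain ⟨σ', M', k, hk, hout, hM', hagree, hle⟩ := h M hM
    have hans : IsAnswer (K j) σ'.screenedOutput := by
      intro w hw
      simp only [State.screenedOutput] at hw
      split_ifs at hw
      simp_all
    -- A run at a shift leaves the table unchanged up to that shift, so the slot is still empty when
    -- its result is stored and the size grows by exactly one.
    have hsize := Table.size_update hN ((hagree j _ le_rfl).trans hv) σ'.screenedOutput
    refine ⟨σ'.screenedOutput, _, 1 + k, .callRun (.inr hv) hk, hans, ?_, ?_, ?_⟩
    · intro i t v hit
      rw [if_pos rfl, Function.update_apply] at hit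
      split_ifs at hit with he
      · cases he
        cases hit
        exact hans
      · exact hM' _ _ _ hit
    · intro i t ht
      rw [if_pos rfl, Function.update_of_ne (by simp; omega)]
      exact hagree i t (by omega)
    · rw [if_pos rfl, hsize]
      linarith

/-- The calls are nested in front of a continuation, so the run is described by how it extends an
arbitrary run of `c`. -/
theorem exec_foldr_call {K : Fin n → ℕ} {N B s a t : ℕ} (ht : t ≠ 0) (hN : s + t ≤ N)
    (h : ∀ j, HaltsWithin p r x K N B (s + t) j) (l : List (Fin n)) {σ : State} (hσ : σ.mem a = t)
    {M : Table n} (hM : M.Valid K) :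
    ∃ vs M' k, List.Forall₂ (fun j v => IsAnswer (K j) v) l vs ∧ M'.Valid K ∧
      Table.AgreeUpTo s M M' ∧ k + B * M.size N ≤ l.length + B * M'.size N ∧
      ∀ c σ₁ M₁ k₁, Exec p true r x s c (σ.pushAll vs) M' σ₁ M₁ k₁ →
        Exec p true r x s (l.foldr (fun j c' => .seq (.call j a) c') c) σ M σ₁ M₁ (k + k₁) := by
  induction l generalizing σ M with
  | nil =>
    refine ⟨[], M, 0, .nil, hM, .refl _ _, by simp, fun c σ₁ M₁ k₁ h => ?_⟩
    simpa [State.pushAll] using h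
  | cons j l ih =>
    subst hσ
    obtain ⟨v, M₁, k₁, h₁, hv, hM₁, hag₁, hle₁⟩ := (h j).exec_call ht hN hM
    obtain ⟨vs, M₂, k₂, hvs, hM₂, hag₂, hle₂, h₂⟩ := ih (σ := σ.push v) rfl hM₁
    refine ⟨v :: vs, M₂, k₁ + k₂, .cons hv hvs, hM₂, hag₁.trans hag₂, ?_, fun c σ' M' k' h' => ?_⟩
    · rw [List.length_cons]
      linarith
    · rw [add_assoc]
      exact h₁.seq (h₂ c σ' M' k' (by simpa [State.pushAll, State.push] using h'))

theorem IsHistory.append {K : Fin n → ℕ} {t : ℕ} {h vs : List (Option ℕ)} (hh : IsHistory K t h)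
    (hvs : List.Forall₂ (fun j v => IsAnswer (K j) v) (List.finRange n) vs) :
    IsHistory K (t + 1) (h ++ vs) := by
  have hlen : vs.length = n := by simpa using hvs.length_eq.symm
  refine ⟨by rw [List.length_append, hh.1, hlen]; ring, fun τ hτ j v hv => ?_⟩
  rcases Nat.lt_succ_iff_lt_or_eq.1 hτ with hτ | rfl
  · rw [List.getElem?_append_left] at hv
    · exact hh.2 τ hτ j v hv
    · rw [hh.1]
      calc τ * n + j < τ * n + n := by omega
        _ = (τ + 1) * n := by ring
        _ ≤ t * n := Nat.mul_le_mul_right n hτ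
  · rw [List.getElem?_append_right (by rw [hh.1]; omega), hh.1, Nat.add_sub_cancel_left] at hv
    obtain ⟨hj, hv⟩ := List.getElem?_eq_some_iff.1 hv
    have := hvs.get (i := j) (by simp) hj
    simp only [List.get_eq_getElem, List.getElem_finRange] at this
    exact this v hv

/-- A round costs `n + 2` steps apart from the simulated runs: a loop test, `n` calls and a
decrement. The last test gives the `+ 1`. -/
theorem exec_simulate {K : Fin n → ℕ} {N B s : ℕ} {ε ρ : ℝ} (t : ℕ) (hN : s + t ≤ N)
    (h : ∀ s' j, s < s' → s' ≤ N → HaltsWithin p r x K N B s' j) {τ : ℕ} {hist : List (Option ℕ)}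
    (hh : IsHistory K τ hist) {M : Table n} (hM : M.Valid K) :
    ∃ hist' M' k, IsHistory K (τ + t) hist' ∧ M'.Valid K ∧ Table.AgreeUpTo s M M' ∧
      k + B * M.size N ≤ (n + 2) * t + 1 + B * M'.size N ∧
      Exec p true r x s (simulate n) (botState t 0 ε ρ hist) M (botState 0 0 ε ρ hist') M' k := by
  induction t generalizing τ hist M with
  | zero =>
    refine ⟨hist, M, 1, hh, hM, .refl _ _, by simp, .loopDone (by simp [botState])⟩
  | succ t ih =>
    obtain ⟨vs, M₁, k₁, hvs, hM₁, hag₁, hle₁, h₁⟩ := exec_foldr_call (a := 0) (Nat.succ_ne_zero t) hN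
      (fun j => h (s + (t + 1)) j (by omega) hN) (List.finRange n)
      (σ := botState (t + 1) 0 ε ρ hist) (by simp [botState]) hM
    obtain ⟨hist', M₂, k₂, hh', hM₂, hag₂, hle₂, h₂⟩ := ih (by omega) (hh.append hvs) hM₁
    have hdec := Exec.instr (p := p) (memo := true) (r := r) (x := x) s (.dec 0)
      (botState (t + 1) 0 ε ρ (hist ++ vs)) M₁
    rw [Instr.exec, setMem_zero_botState] at hdec
    refine ⟨hist', M₂, 1 + (k₁ + 1) + k₂, ?_, hM₂, hag₁.trans hag₂, ?_,
      .loopStep (by simp [botState]) (h₁ _ _ _ _ hdec) h₂⟩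
    · rwa [show τ + (t + 1) = τ + 1 + t by ring]
    · rw [List.length_finRange] at hle₁
      linarith

/-- A bound for the steps of a bot that makes at most `N` rounds of simulations, not counting the steps of
the simulated runs. -/
noncomputable def ownSteps (n : ℕ) (Q : Polynomial ℕ) (N : ℕ) : ℕ := (n + 7) * (N + 1) + Q.eval N

theorem eval_mono_nat (Q : Polynomial ℕ) {a b : ℕ} (h : a ≤ b) : Q.eval a ≤ Q.eval b := by
  rw [Polynomial.eval_eq_sum_range, Polynomial.eval_eq_sum_range]
  gcongr

theorem eval_le_mul_pow (Q : Polynomial ℕ) (N : ℕ) :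
    Q.eval N ≤ Q.eval 1 * (N + 1) ^ Q.natDegree := by
  rw [Polynomial.eval_eq_sum_range, Polynomial.eval_eq_sum_range, Finset.sum_mul]
  refine Finset.sum_le_sum fun i hi => ?_
  rw [one_pow, mul_one]
  refine Nat.mul_le_mul_left _ ?_
  calc N ^ i ≤ (N + 1) ^ i := Nat.pow_le_pow_left (by omega) _
    _ ≤ (N + 1) ^ Q.natDegree := Nat.pow_le_pow_right (by omega) (by simpa [Nat.lt_succ_iff] using hi)

theorem runtime_eq_of_exec {q : Fin n → Code n} {memo : Bool} {c : Code n} {h : List (Option ℕ)}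
    {σ : State} {M : Table n} {k : ℕ}
    (hk : Exec q memo r x 0 c (State.init h) (fun _ => none) σ M k) :
    runtime q memo r x c h = k := by
  refine le_antisymm (sInf_le ⟨σ, M, k, hk, rfl⟩) (le_sInf ?_)
  rintro _ ⟨σ', M', k', hk', rfl⟩
  rw [(hk.det hk').2.2]

/-- Induction on the distance `d` from `s` to `N`: since `r_N` is below every threshold, `T ≤ d`,
and all simulations are at shifts in `(s, N]`. -/
theorem haltsWithin_groundedBot {K : Fin n → ℕ} {Q : Polynomial ℕ} {ε₀ : ℝ} {ε : Fin n → ℝ}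
    {π : Fin n → Code n} (hε : ∀ i, ε₀ ≤ ε i) (hp : ∀ i, p i = groundedBot (ε i) (π i))
    (hπ : ∀ i, IsPolicy K i (π i)) (hQ : ∀ i, RunsInTime K (π i) Q) {N : ℕ} (hN : (r N : ℝ) < ε₀)
    (d s : ℕ) (hs : s + d = N) (j : Fin n) : HaltsWithin p r x K N (ownSteps n Q N) s j := by
  induction d using Nat.strong_induction_on generalizing s j with
  | _ d ih =>
    intro M hM
    obtain ⟨T, hTd, hT⟩ := exists_isFirstBelow (r := r) (s := s) (t := d) (ε := ε j)
      (by rw [hs]; exact hN.trans_le (hε j))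
    obtain ⟨h, M', k, hh, hM', hag, hle, hk⟩ := exec_simulate (p := p) (x := x) (ε := ε j)
      (ρ := r (s + T)) T (show s + T ≤ N by omega)
      (fun s' j h h' => ih (N - s') (by omega) s' (by omega) j)
      (τ := 0) (hist := []) ⟨by simp, by simp⟩ hM
    rw [zero_add] at hh
    -- The policy is specified for runs at shift `0` among trivial programs, so it is run there on
    -- the shifted sequence and then transported.
    obtain ⟨σ, M₀, k₀, hk₀, hout⟩ := (hπ j).halts T h hh (fun m => r (s + m)) x
    have hrun := hQ j T h hh (fun m => r (s + m)) x
    rw [runtime_eq_of_exec hk₀, Nat.cast_le] at hrun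
    have hpol := hk₀.transport_of_isLocal (q := p) (memo' := true) (r' := r) (x' := x) (s' := s)
      (by simp) rfl (hπ j).isLocal M'
    have h₁ := Exec.instr (p := p) (memo := true) (r := r) (x := x) s (.rconst 0 0)
      (botState 0 0 (ε j) (r (s + T)) h) M'
    have h₂ := Exec.instr (p := p) (memo := true) (r := r) (x := x) s (.rconst 1 0)
      (botState 0 0 0 (r (s + T)) h) M'
    rw [Instr.exec, setReal_zero_botState] at h₁
    rw [Instr.exec, setReal_one_botState, botState_zero] at h₂
    refine ⟨σ, M', 4 * T + 4 + (k + (1 + (1 + k₀))), ?_, hout, hM', hag, ?_⟩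
    · rw [hp j]
      exact (exec_findT hT M).seq (hk.seq (h₁.seq (h₂.seq hpol)))
    · have hQT := eval_mono_nat Q (show T ≤ N by omega)
      have hmul : (n + 6) * T ≤ (n + 6) * N := Nat.mul_le_mul_left _ (by omega)
      have hown : (n + 6) * T + 7 + k₀ ≤ ownSteps n Q N := by
        rw [ownSteps]
        linarith
      linarith

theorem runtime_groundedBot_le {K : Fin n → ℕ} {Q : Polynomial ℕ} {ε₀ : ℝ} {ε : Fin n → ℝ}
    {π : Fin n → Code n} (hε : ∀ i, ε₀ ≤ ε i) (hπ : ∀ i, IsPolicy K i (π i))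
    (hQ : ∀ i, RunsInTime K (π i) Q) {N : ℕ} (hN : (r N : ℝ) < ε₀) (i : Fin n) :
    runtime (fun j => groundedBot (ε j) (π j)) true r x (groundedBot (ε i) (π i)) [] ≤
      ((n + 7 + Q.eval 1) * (n + 1) * (N + 1) ^ (Q.natDegree + 2) : ℕ) := by
  obtain ⟨σ, M, k, hk, -, -, -, hle⟩ := haltsWithin_groundedBot (x := x) hε (fun _ => rfl) hπ hQ hN N 0
    (by simp) i (fun _ => none) (fun _ _ _ h => by simp at h)
  rw [runtime_eq_of_exec hk, Nat.cast_le]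
  have hB : ownSteps n Q N ≤ (n + 7 + Q.eval 1) * (N + 1) ^ (Q.natDegree + 1) := by
    rw [ownSteps, add_mul (n + 7)]
    have h₁ : (N + 1) ^ 1 ≤ (N + 1) ^ (Q.natDegree + 1) := Nat.pow_le_pow_right (by omega) (by omega)
    have h₂ : (N + 1) ^ Q.natDegree ≤ (N + 1) ^ (Q.natDegree + 1) :=
      Nat.pow_le_pow_right (by omega) (by omega)
    exact add_le_add (Nat.mul_le_mul_left _ ((pow_one (N + 1)).ge.trans h₁))
      ((eval_le_mul_pow Q N).trans (Nat.mul_le_mul_left _ h₂))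
  -- One share of `ownSteps` for the run itself and one for each of the at most `n (N+1)` table
  -- entries.
  calc k ≤ ownSteps n Q N * (1 + M.size N) := by rw [Table.size_empty] at hle; linarith
    _ ≤ (n + 7 + Q.eval 1) * (N + 1) ^ (Q.natDegree + 1) * ((n + 1) * (N + 1)) := by
        refine Nat.mul_le_mul hB ?_
        have := M.size_le N
        linarith
    _ = _ := by ring

end ProgramGame

/-! ### Moments of the first index below the threshold -/

namespace ProgramGame

variable {n : ℕ}

open scoped Nat in
theorem succ_pow_le_factorial_mul_choose (N D : ℕ) : (N + 1) ^ D ≤ D ! * (N + D).choose D :=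
  (Nat.pow_succ_le_ascFactorial (N + 1) D).trans (Nat.ascFactorial_eq_factorial_mul_choose N D).le

/-- The sequences whose first `t` entries are at least `ε`. -/
def noneBelow (ε : ℝ) (t : ℕ) : Set (ℕ → unitInterval) :=
  Set.pi (Finset.range t) fun _ => {u : unitInterval | ε ≤ u}

theorem mem_noneBelow {ε : ℝ} {t : ℕ} {r : ℕ → unitInterval} :
    r ∈ noneBelow ε t ↔ ∀ m < t, ε ≤ r m := by
  simp [noneBelow, Set.mem_pi]

theorem measurableSet_noneBelow (ε : ℝ) (t : ℕ) : MeasurableSet (noneBelow ε t) :=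
  .pi (Finset.range t).countable_toSet fun _ _ => measurableSet_le_coe ε

theorem uniformSeq_noneBelow {ε : ℝ} (h₀ : 0 ≤ ε) (h₁ : ε ≤ 1) (t : ℕ) :
    uniformSeq (noneBelow ε t) = ENNReal.ofReal (1 - ε) ^ t := by
  rw [noneBelow, Measure.infinitePi_pi _ fun _ _ => measurableSet_le_coe ε]
  simp [volume_le_coe h₀ h₁]

/-- An upper bound, up to a constant factor, for powers of the least `N` with `r_N < ε`. -/
noncomputable def hitBound (ε : ℝ) (D : ℕ) (r : ℕ → unitInterval) : ℝ≥0∞ :=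
  ∑' t : ℕ, (noneBelow ε t).indicator (fun _ => ((t + D).choose D : ℝ≥0∞)) r

theorem measurable_hitBound (ε : ℝ) (D : ℕ) : Measurable (hitBound ε D) :=
  Measurable.tsum fun t => measurable_const.indicator (measurableSet_noneBelow ε t)

/-- Integrating term by term gives the negative binomial series `∑ (t+D choose D) (1-ε)^t =
ε^{-(D+1)}`. -/
theorem lintegral_hitBound {ε : ℝ} (h₀ : 0 < ε) (h₁ : ε ≤ 1) (D : ℕ) :
    ∫⁻ r, hitBound ε D r ∂uniformSeq = ENNReal.ofReal ((1 / ε) ^ (D + 1)) := by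
  have hnorm : ‖1 - ε‖ < 1 := by rw [Real.norm_of_nonneg (by linarith)]; linarith
  have hsum := hasSum_choose_mul_geometric_of_norm_lt_one D hnorm
  simp only [hitBound]
  rw [lintegral_tsum fun t =>
    (measurable_const.indicator (measurableSet_noneBelow ε t)).aemeasurable]
  simp_rw [lintegral_indicator_const (measurableSet_noneBelow ε _),
    uniformSeq_noneBelow h₀.le h₁]
  rw [sub_sub_cancel, ← one_div_pow] at hsum
  rw [← hsum.tsum_eq, ENNReal.ofReal_tsum_of_nonneg _ hsum.summable]
  · refine tsum_congr fun t => ?_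
    rw [ENNReal.ofReal_mul (by positivity), ENNReal.ofReal_natCast,
      ENNReal.ofReal_pow (by linarith)]
  · exact fun t => mul_nonneg (by positivity) (pow_nonneg (by linarith) _)

open scoped Nat in
-- If `N` is the first index below `ε₀`, the summand `t = N` of `hitBound` already dominates
-- `(N+1)^D / D!`. If there is no such index, `hitBound` is infinite, so the bound holds for every
-- sequence and null sets need no separate treatment.
theorem runtime_groundedBot_le_hitBound {K : Fin n → ℕ} {Q : Polynomial ℕ} {ε₀ : ℝ} {ε : Fin n → ℝ}
    {π : Fin n → Code n} (hε : ∀ i, ε₀ ≤ ε i) (hπ : ∀ i, IsPolicy K i (π i))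
    (hQ : ∀ i, RunsInTime K (π i) Q) (r x : ℕ → unitInterval) (i : Fin n) :
    (runtime (fun j => groundedBot (ε j) (π j)) true r x (groundedBot (ε i) (π i)) [] : ℝ≥0∞) ≤
      ((n + 7 + Q.eval 1) * (n + 1) * (Q.natDegree + 2)! : ℕ) * hitBound ε₀ (Q.natDegree + 2) r := by
  set D := Q.natDegree + 2 with hD
  set c := (n + 7 + Q.eval 1) * (n + 1) with hc
  have hc0 : (c * D ! : ℕ) ≠ 0 := by positivity
  by_cases hr : ∃ N, (r N : ℝ) < ε₀
  · obtain ⟨t, ht⟩ := hr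
    obtain ⟨N, -, hN⟩ := exists_isFirstBelow (r := r) (s := 0) (t := t) (ε := ε₀) (by simpa using ht)
    simp only [IsFirstBelow, zero_add] at hN
    have h₁ := ENat.toENNReal_mono
      (runtime_groundedBot_le (r := r) (x := x) hε hπ hQ hN.2 i)
    rw [ENat.toENNReal_coe, ← hD, ← hc] at h₁
    have h₂ : ((N + D).choose D : ℝ≥0∞) ≤ hitBound ε₀ D r := by
      refine le_trans ?_ (ENNReal.le_tsum N)
      rw [Set.indicator_of_mem (mem_noneBelow.2 hN.1)]
    calc _ ≤ ((c * (N + 1) ^ D : ℕ) : ℝ≥0∞) := h₁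
      _ ≤ ((c * (D ! * (N + D).choose D) : ℕ) : ℝ≥0∞) := by
          exact_mod_cast Nat.mul_le_mul_left c (succ_pow_le_factorial_mul_choose N D)
      _ = ((c * D ! : ℕ) : ℝ≥0∞) * ((N + D).choose D : ℝ≥0∞) := by push_cast; ring
      _ ≤ _ := by gcongr
  · have htop : hitBound ε₀ D r = ⊤ := by
      refine top_le_iff.1 ?_
      calc (⊤ : ℝ≥0∞) = ∑' _ : ℕ, 1 := (ENNReal.tsum_const_eq_top_of_ne_zero one_ne_zero).symm
        _ ≤ _ := by
          refine ENNReal.tsum_le_tsum fun t => ?_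
          rw [Set.indicator_of_mem (mem_noneBelow.2 fun m _ => not_lt.1 fun h => hr ⟨m, h⟩)]
          exact_mod_cast Nat.choose_pos (Nat.le_add_left D t)
    rw [htop, ENNReal.mul_top (by exact_mod_cast hc0)]
    exact le_top

open scoped Nat in
/-- With memoization, the expected runtime of grounded bots is polynomial in the inverse of a lower bound
for their thresholds. -/
theorem expectedRuntime_le {K : Fin n → ℕ} {Q : Polynomial ℕ} {ε₀ : ℝ} {ε : Fin n → ℝ}
    {π : Fin n → Code n} (h₀ : 0 < ε₀) (h₁ : ε₀ ≤ 1) (hε : ∀ i, ε₀ ≤ ε i)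
    (hπ : ∀ i, IsPolicy K i (π i)) (hQ : ∀ i, RunsInTime K (π i) Q) (i : Fin n) :
    expectedRuntime (fun j => groundedBot (ε j) (π j)) true i ≤
      ENNReal.ofReal (((n + 7 + Q.eval 1) * (n + 1) * (Q.natDegree + 2)! : ℕ) *
        (1 / ε₀) ^ (Q.natDegree + 3)) := by
  set c := (n + 7 + Q.eval 1) * (n + 1) * (Q.natDegree + 2)!
  have hm := measurable_hitBound ε₀ (Q.natDegree + 2)
  calc _ ≤ ∫⁻ ω, c * hitBound ε₀ (Q.natDegree + 2) ω.1 ∂(uniformSeq.prod uniformSeq) :=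
        lintegral_mono fun ω => runtime_groundedBot_le_hitBound hε hπ hQ ω.1 ω.2 i
    _ = c * ∫⁻ r, hitBound ε₀ (Q.natDegree + 2) r ∂uniformSeq := by
        rw [lintegral_const_mul _ (show Measurable fun ω : (ℕ → unitInterval) × (ℕ → unitInterval) =>
          hitBound ε₀ (Q.natDegree + 2) ω.1 from hm.comp measurable_fst),
          measurePreserving_fst.lintegral_comp hm]
    _ = _ := by
        rw [lintegral_hitBound h₀ h₁, ENNReal.ofReal_mul (by positivity), ENNReal.ofReal_natCast]

end ProgramGame

/-! ### The two halves combined -/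

theorem mainTheorem10 (n : ℕ) :
    -- without memoization
    (∀ (K : Fin n → ℕ) (ε : Fin n → ℝ) (π : Fin n → ProgramGame.Code n),
      (∀ i, ProgramGame.IsPolicy K i (π i)) →
      (∃ i j, i ≠ j ∧ ε i < 1 / 2 ∧ ε j < 1 / 2) →
      ∀ i, ε i < 1 →
        ProgramGame.expectedRuntime (fun j => ProgramGame.groundedBot (ε j) (π j)) false i = ⊤) ∧
    -- with memoization
    (∀ Q : Polynomial ℕ, ∃ P : Polynomial ℝ,
      ∀ (K : Fin n → ℕ) (ε : Fin n → ℝ) (π : Fin n → ProgramGame.Code n),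
        (∀ i, 0 < ε i) →
        (∀ i, ProgramGame.IsPolicy K i (π i)) →
        (∀ i, ProgramGame.RunsInTime K (π i) Q) →
        ∀ i,
          ProgramGame.expectedRuntime (fun j => ProgramGame.groundedBot (ε j) (π j)) true i < ⊤ ∧
          ProgramGame.expectedRuntime (fun j => ProgramGame.groundedBot (ε j) (π j)) true i ≤
            ENNReal.ofReal (P.eval (1 / ⨅ j, ε j))) := by
  refine ⟨fun K ε π _ ⟨j, _, _, hj, _⟩ i hi => ProgramGame.expectedRuntime_eq_top hj hi,
    fun Q => ?_⟩
  set c : ℕ := (n + 7 + Q.eval 1) * (n + 1) * (Q.natDegree + 2).factorial with hc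
  -- The summand `1` covers thresholds that all exceed `1`: the moment bound is then applied with
  -- `ε₀ = 1`, where it equals `c`, while `1 / ⨅ j, ε j` may be arbitrarily small.
  refine ⟨.C (c : ℝ) * (.X ^ (Q.natDegree + 3) + 1), fun K ε π hε hπ hQ i => ?_⟩
  have : Nonempty (Fin n) := ⟨i⟩
  obtain ⟨l, hl⟩ := exists_eq_ciInf_of_finite (f := ε)
  have hpos : 0 < ⨅ j, ε j := hl ▸ hε l
  have hle : ∀ j, ⨅ j, ε j ≤ ε j := fun j => ciInf_le (Set.finite_range ε).bddBelow j
  have hbound := ProgramGame.expectedRuntime_le (lt_min hpos one_pos) (min_le_right _ 1)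
    (fun j => (min_le_left _ _).trans (hle j)) hπ hQ i
  have hfin := hbound.trans (ENNReal.ofReal_le_ofReal (?_ : _ ≤
    (Polynomial.C (c : ℝ) * (.X ^ (Q.natDegree + 3) + 1)).eval (1 / ⨅ j, ε j)))
  · exact ⟨hfin.trans_lt ENNReal.ofReal_lt_top, hfin⟩
  · rw [← hc]
    simp only [Polynomial.eval_mul, Polynomial.eval_C, Polynomial.eval_add, Polynomial.eval_pow,
      Polynomial.eval_X, Polynomial.eval_one]
    refine mul_le_mul_of_nonneg_left ?_ (Nat.cast_nonneg c)
    rcases le_total (⨅ j, ε j) 1 with h | h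
    · rw [min_eq_left h]
      linarith
    · rw [min_eq_right h]
      have : 0 ≤ (1 / ⨅ j, ε j) ^ (Q.natDegree + 3) := by positivity
      simpa using this
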